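/- Let $\psi(q)=\sum_{k\ge 0}q^{k(k+1)/2}$ and define the integers $ps_3(n)$, $n\ge 0$, by the identity of formal power series $$\sum_{n\ge 0}ps_3(n)\,q^n=\frac{\psi(q^3)}{\psi(q)}.$$ Then for all integers $m\ge 1$ and $n\ge 0$, $$ps_3\!\left(3^{2m+1}n+\frac{3^{2m+2}-1}{4}\right)\equiv ps_3\!\left(3^{2m-1}n+\frac{3^{2m}-1}{4}\right)\pmod{3^{m+2}}.$$ -/

import Mathlib

open scoped Classical in
/-- Ramanujan's theta function `ψ(q) = ∑_{k ≥ 0} q^{k(k+1)/2}`, as a formal power series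
over `ℤ`. The numbers `k(k+1)/2`, `k ≥ 0`, are pairwise distinct, so every coefficient
is `0` or `1`. -/
noncomputable def ramanujanPsi : PowerSeries ℤ :=
  PowerSeries.mk fun n => if ∃ k : ℕ, k * (k + 1) / 2 = n then 1 else 0

/-- The quotient `ψ(q ^ 3) / ψ(q)` of formal power series; `ψ` has constant term `1`, hence it is
invertible over `ℤ` (see `psQuotient_mul_ramanujanPsi`). -/
noncomputable def psQuotient : PowerSeries ℤ :=
  PowerSeries.expand 3 three_ne_zero ramanujanPsi * PowerSeries.invOfUnit ramanujanPsi 1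

/-- `ps₃(n)`, the coefficient of `q ^ n` in `ψ(q ^ 3) / ψ(q)`. -/
noncomputable def ps3 (n : ℕ) : ℤ := PowerSeries.coeff n psQuotient

theorem constantCoeff_ramanujanPsi : PowerSeries.constantCoeff ramanujanPsi = 1 := by
  rw [← PowerSeries.coeff_zero_eq_constantCoeff_apply, ramanujanPsi, PowerSeries.coeff_mk,
    if_pos ⟨0, rfl⟩]

theorem psQuotient_mul_ramanujanPsi :
    psQuotient * ramanujanPsi = PowerSeries.expand 3 three_ne_zero ramanujanPsi := by
  rw [psQuotient, mul_assoc,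
    PowerSeries.invOfUnit_mul _ _ (by simpa using constantCoeff_ramanujanPsi), mul_one]

/-!
Write `ψ` for `ramanujanPsi`, `E` for Euler's product and `U` for the operator
`∑ aₙ qⁿ ↦ ∑ a₃ₙ qⁿ`. The norm of `E` from `R⟦q⟧` to `R⟦q³⟧`, taken over the cube roots of unity, is
`E(q³)⁴ / E(q⁹)`, and Gauss' identity `ψ(q) E(q) = E(q²)²` turns this into the same formula for `ψ`.
Together with the dissection `ψ(q) = a(q³) + q ψ(q⁹)` it gives the cubic theta identity
`(a³ + q ψ(q³)³) ψ(q³) = ψ⁴`.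

Hence `z = q ψ(q¹²) / ψ(q⁴)` is a root of a cubic polynomial whose coefficients are polynomials in
`z(q³)`, so `U` maps `ℤ[z]` to itself by explicit polynomials. The congruence compares coefficients
of `U^[2m + 1] z` and `U^[2m - 1] z`. Their difference is `U^[2m - 1]` applied to
`U² z - z = 9 z⁹ - 9 z⁵`, and `U²` contracts by a factor `3` a lattice of polynomials in `z`
vanishing at `z = 1`.
-/

open PowerSeries Finset Topology
open Filter hiding map

section FiniteProducts

variable {R : Type*} [CommRing R]

/-- The partial product `(x; x)ₙ` of Euler's product. -/
def eulerProd (x : R) (n : ℕ) : R := ∏ i ∈ range n, (1 - x ^ (i + 1))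

/-- The partial product `(x; x²)ₙ`: the odd factors of Euler's product. -/
def oddProd (x : R) (n : ℕ) : R := ∏ i ∈ range n, (1 - x ^ (2 * i + 1))

theorem map_eulerProd {S F : Type*} [CommRing S] [FunLike F R S] [RingHomClass F R S] (f : F)
    (x : R) (n : ℕ) : f (eulerProd x n) = eulerProd (f x) n := by
  simp [eulerProd]

theorem oddProd_succ (x : R) (n : ℕ) :
    oddProd x (n + 1) = oddProd x n * (1 - x ^ (2 * n + 1)) :=
  prod_range_succ _ _

theorem oddProd_mul_eulerProd_sq (x : R) (n : ℕ) :
    oddProd x n * eulerProd (x ^ 2) n = eulerProd x (2 * n) := by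
  induction n with
  | zero => simp [oddProd, eulerProd]
  | succ n ih =>
    rw [oddProd_succ, eulerProd, prod_range_succ, ← eulerProd, mul_mul_mul_comm, ih,
      eulerProd, eulerProd, mul_add, prod_range_succ, prod_range_succ, ← pow_mul]
    ring

theorem shanks_telescope (x : R) (n r : ℕ) (hr : r ≤ n + 1) :
    ∑ s ∈ range r, oddProd x s * (∏ i ∈ Ico (s + 1) (n + 1), (1 - x ^ (2 * i))) *
        x ^ (s * (2 * n + 1)) * ((1 - x ^ (2 * n + 2)) * x ^ (2 * s) - (1 - x ^ (2 * n + 1))) =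
      x ^ (r * (2 * n + 1)) * oddProd x r * ∏ i ∈ Ico r (n + 1), (1 - x ^ (2 * i)) := by
  induction r with
  | zero => simp [prod_range_succ']
  | succ r ih =>
    rw [sum_range_succ, ih (by omega), prod_eq_prod_Ico_succ_bot (show r < n + 1 by omega),
      oddProd_succ]
    ring

/-- Shanks' finite form of Gauss' product for `∑ x ^ (k (k + 1) / 2)`. -/
theorem oddProd_mul_sum_pow_triangle (x : R) (n : ℕ) :
    oddProd x n * ∑ k ∈ range (2 * n + 1), x ^ (k * (k + 1) / 2) =
      ∑ s ∈ range (n + 1), oddProd x s * (∏ i ∈ Ico (s + 1) (n + 1), (1 - x ^ (2 * i))) *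
        x ^ (s * (2 * n + 1)) := by
  induction n with
  | zero => simp [oddProd]
  | succ n ih =>
    have telescope := shanks_telescope x n (n + 1) le_rfl
    simp only [mul_sub, sum_sub_distrib] at telescope
    rw [← sum_mul, ← sum_mul, ← ih, oddProd_succ, Ico_self, prod_empty] at telescope
    have odd_triangle : (2 * n + 1) * (2 * n + 2) / 2 = (n + 1) * (2 * n + 1) :=
      Nat.div_eq_of_eq_mul_left two_pos (by ring)
    have even_triangle : (2 * n + 2) * (2 * n + 3) / 2 = (n + 1) * (2 * n + 3) :=
      Nat.div_eq_of_eq_mul_left two_pos (by ring)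
    have step (s : ℕ) (hs : s ∈ range (n + 1)) :
        oddProd x s * (∏ i ∈ Ico (s + 1) (n + 2), (1 - x ^ (2 * i))) * x ^ (s * (2 * n + 3)) =
          oddProd x s * (∏ i ∈ Ico (s + 1) (n + 1), (1 - x ^ (2 * i))) *
            x ^ (s * (2 * n + 1)) * ((1 - x ^ (2 * n + 2)) * x ^ (2 * s)) := by
      rw [prod_Ico_succ_top (by have := mem_range.1 hs; omega)]
      ring
    rw [sum_range_succ _ (n + 1), show 2 * (n + 1) + 1 = 2 * n + 3 by ring, sum_congr rfl step,
      sum_range_succ, sum_range_succ, odd_triangle, even_triangle, Ico_self, prod_empty,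
      oddProd_succ]
    linear_combination -telescope

end FiniteProducts

section Limits

open scoped PowerSeries.WithPiTopology

variable {R : Type*} [CommRing R] [TopologicalSpace R]

theorem continuous_of_continuous_coeff {T : Type*} [TopologicalSpace T] {g : T → R⟦X⟧}
    (h : ∀ d, Continuous fun t => coeff d (g t)) : Continuous g :=
  continuous_iff_continuousAt.2 fun _ =>
    (WithPiTopology.tendsto_iff_coeff_tendsto R _ _ _).2 fun d => (h d).tendsto _

theorem continuous_expand {p : ℕ} (hp : p ≠ 0) : Continuous (expand p hp : R⟦X⟧ → R⟦X⟧) := by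
  refine continuous_of_continuous_coeff fun d => ?_
  simp only [coeff_expand]
  split_ifs
  exacts [WithPiTopology.continuous_coeff R _, continuous_const]

theorem continuous_rescale [IsTopologicalSemiring R] (a : R) :
    Continuous (rescale a : R⟦X⟧ → R⟦X⟧) := by
  refine continuous_of_continuous_coeff fun d => ?_
  simp only [coeff_rescale]
  exact (WithPiTopology.continuous_coeff R d).const_mul _

theorem tendsto_eulerProd_X [IsTopologicalRing R] [T2Space R] :
    Tendsto (eulerProd (X : R⟦X⟧)) atTop (𝓝 (pentagonalSeries R)) :=
  (PowerSeries.WithPiTopology.hasProd_one_sub_X_pow R).tendsto_prod_nat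

theorem tendsto_X_pow_mul_nhds_zero {e : ℕ → ℕ} (he : Tendsto e atTop atTop) (f : ℕ → R⟦X⟧) :
    Tendsto (fun n => X ^ e n * f n) atTop (𝓝 0) := by
  refine (WithPiTopology.tendsto_iff_coeff_tendsto R _ _ _).2 fun d =>
    tendsto_const_nhds.congr' ?_
  filter_upwards [he.eventually_gt_atTop d] with n hn
  rw [coeff_X_pow_mul', if_neg (by omega), map_zero]

theorem triangle_strictMono : StrictMono fun k : ℕ => k * (k + 1) / 2 :=
  strictMono_nat_of_lt_succ fun k => by
    have : (k + 1) * (k + 1 + 1) = k * (k + 1) + (k + 1) * 2 := by ring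
    simp only [this]
    omega

theorem hasSum_X_pow_triangle :
    HasSum (fun k : ℕ => (X : R⟦X⟧) ^ (k * (k + 1) / 2))
      (map (Int.castRingHom R) ramanujanPsi) := by
  have h := (map (Int.castRingHom R) ramanujanPsi).hasSum_of_monomials_self
  rw [← triangle_strictMono.injective.hasSum_iff fun n hn => ?_] at h
  · convert h using 2 with k
    rw [Function.comp_apply, coeff_map, ramanujanPsi, coeff_mk, if_pos ⟨k, rfl⟩, map_one,
      X_pow_eq]
  · rw [coeff_map, ramanujanPsi, coeff_mk, if_neg (by simpa using hn), map_zero, map_zero]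

theorem tendsto_oddProd_mul_sum_X_pow_triangle [IsTopologicalRing R] [T2Space R] :
    Tendsto (fun n => oddProd (X : R⟦X⟧) n * ∑ k ∈ range (2 * n + 1), X ^ (k * (k + 1) / 2))
      atTop (𝓝 (expand 2 two_ne_zero (pentagonalSeries R))) := by
  have bottom_term (n : ℕ) :
      ∏ i ∈ Ico 1 (n + 1), (1 - X ^ (2 * i)) = expand 2 two_ne_zero (eulerProd (X : R⟦X⟧) n) := by
    simp [eulerProd, prod_Ico_eq_prod_range, ← pow_mul, add_comm 1]
  have split (n : ℕ) :
      oddProd (X : R⟦X⟧) n * ∑ k ∈ range (2 * n + 1), X ^ (k * (k + 1) / 2) =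
        X ^ (2 * n + 1) * (∑ s ∈ range n, oddProd X (s + 1) *
          (∏ i ∈ Ico (s + 2) (n + 1), (1 - X ^ (2 * i))) * X ^ (s * (2 * n + 1))) +
        expand 2 two_ne_zero (eulerProd X n) := by
    rw [oddProd_mul_sum_pow_triangle, sum_range_succ', zero_add, bottom_term, mul_sum]
    congr 1
    · exact sum_congr rfl fun s _ => by ring
    · simp [oddProd]
  simp only [split]
  have exponent_atTop : Tendsto (fun n : ℕ => 2 * n + 1) atTop atTop :=
    tendsto_atTop_mono (fun n => show n ≤ 2 * n + 1 by omega) tendsto_id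
  simpa only [zero_add] using! (tendsto_X_pow_mul_nhds_zero exponent_atTop _).add
    (((continuous_expand two_ne_zero).tendsto _).comp (tendsto_eulerProd_X (R := R)))

end Limits

open scoped PowerSeries.WithPiTopology in
theorem map_ramanujanPsi_mul_pentagonalSeries (R : Type*) [CommRing R] :
    map (Int.castRingHom R) ramanujanPsi * pentagonalSeries R =
      expand 2 two_ne_zero (pentagonalSeries R) ^ 2 := by
  let : TopologicalSpace R := ⊥
  have : DiscreteTopology R := ⟨rfl⟩
  have double_atTop : Tendsto (fun n : ℕ => 2 * n) atTop atTop :=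
    tendsto_atTop_mono (fun n => show n ≤ 2 * n by omega) tendsto_id
  have psi_mul_euler := ((hasSum_X_pow_triangle (R := R)).tendsto_sum_nat.comp
    ((tendsto_add_atTop_nat 1).comp double_atTop)).mul (tendsto_eulerProd_X.comp double_atTop)
  have theta_mul_even := (tendsto_oddProd_mul_sum_X_pow_triangle (R := R)).mul
    (((continuous_expand two_ne_zero).tendsto _).comp tendsto_eulerProd_X)
  rw [← sq] at theta_mul_even
  refine tendsto_nhds_unique (psi_mul_euler.congr fun n => ?_) theta_mul_even
  simp only [Function.comp_apply, map_eulerProd, expand_X]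
  rw [mul_right_comm, oddProd_mul_eulerProd_sq, mul_comm]

section RootsOfUnity

variable {R : Type*} [CommRing R]

/-- The norm of `f` from `R⟦X⟧` to `R⟦X ^ p⟧`, the product of the series `f (w ^ j X)` for a
primitive `p`-th root of unity `w`. -/
noncomputable def rescaleNorm (w : R) (p : ℕ) (f : R⟦X⟧) : R⟦X⟧ :=
  ∏ j ∈ range p, rescale (w ^ j) f

theorem rescaleNorm_mul (w : R) (p : ℕ) (f g : R⟦X⟧) :
    rescaleNorm w p (f * g) = rescaleNorm w p f * rescaleNorm w p g := by
  simp [rescaleNorm, prod_mul_distrib]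

theorem rescale_expand (a : R) {n : ℕ} (hn : n ≠ 0) (f : R⟦X⟧) :
    rescale a (expand n hn f) = expand n hn (rescale (a ^ n) f) := by
  ext d
  simp only [coeff_rescale, coeff_expand]
  split_ifs with hd
  · rw [← pow_mul, Nat.mul_div_cancel' hd]
  · rw [mul_zero]

theorem rescaleNorm_expand (w : R) (p : ℕ) {n : ℕ} (hn : n ≠ 0) (f : R⟦X⟧) :
    rescaleNorm w p (expand n hn f) = expand n hn (rescaleNorm (w ^ n) p f) := by
  simp [rescaleNorm, rescale_expand, map_prod, pow_right_comm w _ n]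

theorem expand_injective {n : ℕ} (hn : n ≠ 0) :
    Function.Injective (expand n hn : R⟦X⟧ → R⟦X⟧) := fun f g h => by
  ext d
  rw [← coeff_expand_mul n hn f, h, coeff_expand_mul]

theorem pentagonalSeries_ne_zero [Nontrivial R] : pentagonalSeries R ≠ 0 := fun h => by
  have := coeff_pentagonalSeries_pentagonal R 0
  simp [h] at this

variable [IsDomain R] {p : ℕ} {w : R}

theorem prod_sub_rootOfUnity_mul (hp : 0 < p) (hw : IsPrimitiveRoot w p) (a b : R) :
    ∏ j ∈ range p, (a - w ^ j * b) = a ^ p - b ^ p := by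
  simpa [Polynomial.eval_prod] using
    (congrArg (Polynomial.eval a) (X_pow_sub_C_eq_prod hw hp (α := b) rfl)).symm

theorem prod_one_sub_rootOfUnity_mul_pow (hp : p.Prime) (hw : IsPrimitiveRoot w p) (x : R)
    (k : ℕ) :
    ∏ j ∈ range p, (1 - (w ^ j * x) ^ k) = if p ∣ k then (1 - x ^ k) ^ p else 1 - (x ^ p) ^ k := by
  simp only [mul_pow, pow_right_comm w _ k]
  split_ifs with hk
  · simp [(hw.pow_eq_one_iff_dvd k).2 hk]
  · have hwk := hw.pow_of_coprime k ((hp.coprime_iff_not_dvd.2 hk).symm)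
    rw [prod_sub_rootOfUnity_mul hp.pos hwk, one_pow, pow_right_comm]

theorem prod_eulerProd_rootOfUnity_mul (hp : p.Prime) (hw : IsPrimitiveRoot w p) (x : R) (m : ℕ) :
    (∏ j ∈ range p, eulerProd (w ^ j * x) (p * m)) * eulerProd ((x ^ p) ^ p) m =
      eulerProd (x ^ p) (p * m) * eulerProd (x ^ p) m ^ p := by
  simp only [eulerProd]
  rw [Finset.prod_comm]
  simp only [prod_one_sub_rootOfUnity_mul_pow hp hw]
  induction m with
  | zero => simp
  | succ m ih =>
    obtain ⟨q, rfl⟩ : ∃ q, p = q + 1 := ⟨p - 1, by have := hp.pos; omega⟩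
    have interior (i : ℕ) (hi : i ∈ range q) : ¬ (q + 1) ∣ (q + 1) * m + i + 1 := by
      rw [add_assoc, Nat.dvd_add_right (dvd_mul_right _ _)]
      exact Nat.not_dvd_of_pos_of_lt i.succ_pos (by have := mem_range.1 hi; omega)
    have boundary : (q + 1) * m + q + 1 = (q + 1) * (m + 1) := by ring
    have split_block (f : ℕ → R) : ∏ i ∈ range ((q + 1) * (m + 1)), f i =
        (∏ i ∈ range ((q + 1) * m), f i) *
          ((∏ i ∈ range q, f ((q + 1) * m + i)) * f ((q + 1) * m + q)) := by
      rw [mul_add_one, prod_range_add, prod_range_succ _ q]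
    rw [split_block, split_block, prod_congr rfl fun i hi => if_neg (interior i hi), boundary,
      if_pos (dvd_mul_right _ _), prod_range_succ _ m, prod_range_succ _ m]
    simp only [pow_mul _ (q + 1) (m + 1), mul_pow]
    linear_combination (∏ i ∈ range q, (1 - (x ^ (q + 1)) ^ ((q + 1) * m + i + 1))) *
      (1 - (x ^ (q + 1)) ^ (m + 1)) ^ (q + 1) * (1 - ((x ^ (q + 1)) ^ (q + 1)) ^ (m + 1)) * ih

open scoped PowerSeries.WithPiTopology in
theorem rescaleNorm_pentagonalSeries_mul (hp : p.Prime) (hw : IsPrimitiveRoot w p) :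
    rescaleNorm w p (pentagonalSeries R) *
        expand p hp.ne_zero (expand p hp.ne_zero (pentagonalSeries R)) =
      expand p hp.ne_zero (pentagonalSeries R) ^ (p + 1) := by
  let : TopologicalSpace R := ⊥
  have : DiscreteTopology R := ⟨rfl⟩
  have mul_atTop : Tendsto (fun m : ℕ => p * m) atTop atTop :=
    tendsto_id.const_mul_atTop' hp.pos
  have euler := tendsto_eulerProd_X (R := R)
  have expand_euler := ((continuous_expand (R := R) hp.ne_zero).tendsto _).comp euler
  have left := (tendsto_finsetProd (range p) fun j _ =>
    ((continuous_rescale (w ^ j)).tendsto _).comp (euler.comp mul_atTop)).mul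
      (((continuous_expand hp.ne_zero).tendsto _).comp expand_euler)
  have right := (expand_euler.comp mul_atTop).mul (expand_euler.pow p)
  rw [← pow_succ'] at right
  refine tendsto_nhds_unique (left.congr fun m => ?_) right
  simp only [Function.comp_apply, map_eulerProd, map_pow, expand_X, rescale_X]
  exact prod_eulerProd_rootOfUnity_mul hp (hw.map_of_injective C_injective) X m

theorem rescaleNorm_mul_of_mul_pentagonalSeries {Ψ : R⟦X⟧}
    (gauss : Ψ * pentagonalSeries R = expand 2 two_ne_zero (pentagonalSeries R) ^ 2)
    (hp : p.Prime) (hp2 : p ≠ 2) (hw : IsPrimitiveRoot w p) :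
    rescaleNorm w p Ψ * expand p hp.ne_zero (expand p hp.ne_zero Ψ) =
      expand p hp.ne_zero Ψ ^ (p + 1) := by
  set E := pentagonalSeries R with hE
  have expand_comm (f : R⟦X⟧) : expand p hp.ne_zero (expand 2 two_ne_zero f) =
      expand 2 two_ne_zero (expand p hp.ne_zero f) := by
    rw [← PowerSeries.expand_mul, ← PowerSeries.expand_mul]
    simp only [mul_comm]
  have norm_gauss : rescaleNorm w p Ψ * rescaleNorm w p E =
      expand 2 two_ne_zero (rescaleNorm (w ^ 2) p E) ^ 2 := by
    rw [← rescaleNorm_mul, gauss, sq, rescaleNorm_mul, rescaleNorm_expand, ← sq]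
  have gauss_p := congrArg (expand p hp.ne_zero) gauss
  simp only [map_mul, map_pow, expand_comm] at gauss_p
  have gauss_pp := congrArg (expand p hp.ne_zero) gauss_p
  simp only [map_mul, map_pow, expand_comm] at gauss_pp
  have norm_E := rescaleNorm_pentagonalSeries_mul hp hw
  have norm_E_sq := congrArg (expand 2 two_ne_zero) (rescaleNorm_pentagonalSeries_mul hp
    (hw.pow_of_coprime 2 ((Nat.coprime_primes Nat.prime_two hp).2 hp2.symm)))
  simp only [map_mul, map_pow, ← hE] at norm_E norm_E_sq
  have E_p_ne_zero : expand p hp.ne_zero E ^ (p + 1) ≠ 0 :=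
    pow_ne_zero _ ((map_ne_zero_iff _ (expand_injective _)).2 pentagonalSeries_ne_zero)
  refine mul_right_cancel₀ E_p_ne_zero ?_
  calc rescaleNorm w p Ψ * expand p hp.ne_zero (expand p hp.ne_zero Ψ) *
        expand p hp.ne_zero E ^ (p + 1)
      = (rescaleNorm w p Ψ * rescaleNorm w p E) * (expand p hp.ne_zero (expand p hp.ne_zero Ψ) *
          expand p hp.ne_zero (expand p hp.ne_zero E)) := by rw [← norm_E]; ring
    _ = (expand 2 two_ne_zero (rescaleNorm (w ^ 2) p E) *
          expand 2 two_ne_zero (expand p hp.ne_zero (expand p hp.ne_zero E))) ^ 2 := by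
        rw [norm_gauss, gauss_pp]; ring
    _ = (expand p hp.ne_zero Ψ * expand p hp.ne_zero E) ^ (p + 1) := by
        rw [norm_E_sq, gauss_p]; ring
    _ = expand p hp.ne_zero Ψ ^ (p + 1) * expand p hp.ne_zero E ^ (p + 1) := mul_pow ..

end RootsOfUnity

section Contract

variable {R : Type*} [CommRing R] (p : ℕ)

/-- The operator `∑ aₙ Xⁿ ↦ ∑ aₚₙ Xⁿ` on power series, usually written `U_p`; a left inverse of
`PowerSeries.expand p`. -/
noncomputable def contract : R⟦X⟧ →ₗ[R] R⟦X⟧ where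
  toFun f := mk fun n => coeff (p * n) f
  map_add' f g := by ext; simp
  map_smul' c f := by ext; simp

@[simp]
theorem coeff_contract (f : R⟦X⟧) (n : ℕ) : coeff n (contract p f) = coeff (p * n) f := by
  simp [contract]

theorem coeff_contract_iterate (k : ℕ) (f : R⟦X⟧) (n : ℕ) :
    coeff n ((contract p)^[k] f) = coeff (p ^ k * n) f := by
  induction k generalizing n with
  | zero => simp
  | succ k ih => rw [Function.iterate_succ_apply', coeff_contract, ih, pow_succ, mul_assoc]

variable {p}

theorem contract_expand_mul (hp : p ≠ 0) (g f : R⟦X⟧) :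
    contract p (expand p hp g * f) = g * contract p f := by
  ext n
  rw [coeff_contract, coeff_mul, coeff_mul]
  refine (sum_of_injOn (fun a => (p * a.1, p * a.2)) ?_ ?_ ?_ ?_).symm
  · exact fun a _ b _ h => by simpa [Prod.ext_iff, hp] using h
  · exact fun a h => by simpa [hp, ← mul_add] using h
  · rintro ⟨a, b⟩ hab not_image
    rw [coeff_expand_of_not_dvd, zero_mul]
    rintro ⟨c, rfl⟩
    obtain ⟨d, rfl⟩ : p ∣ b := (Nat.dvd_add_right (dvd_mul_right p c)).1
      (mem_antidiagonal.1 hab ▸ dvd_mul_right p n)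
    exact not_image ⟨(c, d), by simpa [hp, ← mul_add] using hab, rfl⟩
  · exact fun a _ => by simp

theorem contract_one (hp : p ≠ 0) : contract p (1 : R⟦X⟧) = 1 := by
  ext n
  simp [coeff_one, hp]

theorem contract_expand (hp : p ≠ 0) (f : R⟦X⟧) : contract p (expand p hp f) = f := by
  simpa [contract_one hp] using contract_expand_mul hp f 1

theorem contract_X_pow {k : ℕ} (hk : ¬ p ∣ k) : contract p (X ^ k : R⟦X⟧) = 0 := by
  ext n
  rw [coeff_contract, coeff_X_pow, if_neg (fun h => hk ⟨n, h.symm⟩), map_zero]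

end Contract

theorem exists_triangle_eq_iff_of_not_three_dvd {n : ℕ} (hn : ¬ 3 ∣ n) :
    (∃ k, k * (k + 1) / 2 = n) ↔ ∃ j, 9 * (j * (j + 1) / 2) + 1 = n := by
  have double (k : ℕ) : 2 * (k * (k + 1) / 2) = k * (k + 1) :=
    Nat.mul_div_cancel' (Nat.even_mul_succ_self k).two_dvd
  have three_mul_add_one (j : ℕ) :
      (3 * j + 1) * (3 * j + 1 + 1) / 2 = 9 * (j * (j + 1) / 2) + 1 := by
    have h := double j
    have h' := double (3 * j + 1)
    nlinarith
  refine ⟨?_, fun ⟨j, hj⟩ => ⟨3 * j + 1, (three_mul_add_one j).trans hj⟩⟩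
  rintro ⟨k, rfl⟩
  have not_dvd : ¬ 3 ∣ k * (k + 1) := fun h => hn (by have := double k; omega)
  obtain ⟨j, rfl⟩ : ∃ j, k = 3 * j + 1 := by
    refine ⟨k / 3, ?_⟩
    have h0 : ¬ 3 ∣ k := fun h => not_dvd (h.mul_right _)
    have h2 : ¬ 3 ∣ k + 1 := fun h => not_dvd (h.mul_left _)
    omega
  exact ⟨j, (three_mul_add_one j).symm⟩

theorem ramanujanPsi_eq_expand_add : ramanujanPsi =
    expand 3 three_ne_zero (contract 3 ramanujanPsi) +
      X * expand 3 three_ne_zero (expand 3 three_ne_zero ramanujanPsi) := by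
  classical
  ext n
  rw [← PowerSeries.expand_mul, map_add, coeff_expand, coeff_contract]
  rcases n with _ | n
  · simp
  rw [coeff_succ_X_mul, coeff_expand]
  by_cases h3 : 3 ∣ n + 1
  · rw [if_pos h3, Nat.mul_div_cancel' h3, if_neg (by omega), add_zero]
  rw [if_neg h3, zero_add]
  simp only [ramanujanPsi, coeff_mk, exists_triangle_eq_iff_of_not_three_dvd h3, add_left_inj,
    ← ite_and]
  refine if_congr ⟨?_, ?_⟩ rfl rfl
  · rintro ⟨j, rfl⟩
    exact ⟨by simp, j, by omega⟩
  · rintro ⟨h9, j, hj⟩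
    exact ⟨j, by omega⟩

theorem rescaleNorm_expand_add_X_mul_expand {R : Type*} [CommRing R] [IsDomain R] {p : ℕ} {w : R}
    (hp : Odd p) (hw : IsPrimitiveRoot w p) (f g : R⟦X⟧) :
    rescaleNorm w p (expand p hp.pos.ne' f + X * expand p hp.pos.ne' g) =
      expand p hp.pos.ne' (f ^ p + X * g ^ p) := by
  have factor (j : ℕ) : rescale (w ^ j) (expand p hp.pos.ne' f + X * expand p hp.pos.ne' g) =
      expand p hp.pos.ne' f - C w ^ j * -(X * expand p hp.pos.ne' g) := by
    rw [map_add, map_mul, rescale_expand, rescale_expand, pow_right_comm, hw.pow_eq_one, one_pow,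
      rescale_one, rescale_X, map_pow]
    simp only [RingHom.id_apply]
    ring
  simp only [rescaleNorm, factor]
  rw [prod_sub_rootOfUnity_mul hp.pos (hw.map_of_injective C_injective), hp.neg_pow]
  simp [mul_pow]

theorem cubic_identity :
    (contract 3 ramanujanPsi ^ 3 + X * expand 3 three_ne_zero ramanujanPsi ^ 3) *
      expand 3 three_ne_zero ramanujanPsi = ramanujanPsi ^ 4 := by
  have hw := Complex.isPrimitiveRoot_exp 3 three_ne_zero
  have norm_psi := rescaleNorm_mul_of_mul_pentagonalSeries
    (map_ramanujanPsi_mul_pentagonalSeries ℂ) Nat.prime_three (by norm_num) hw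
  have map_psi := congrArg (map (Int.castRingHom ℂ)) ramanujanPsi_eq_expand_add
  simp only [map_add, map_mul, map_X, map_expand] at map_psi
  refine map_injective (Int.castRingHom ℂ) Int.cast_injective (expand_injective three_ne_zero ?_)
  have norm_eq := (congrArg (rescaleNorm _ 3) map_psi).trans
    (rescaleNorm_expand_add_X_mul_expand (by decide) hw _ _)
  simp only [map_mul, map_add, map_pow, map_X, map_expand] at norm_eq ⊢
  rw [← norm_psi, norm_eq]

theorem exists_psQuotient_relations : ∃ H : ℤ⟦X⟧,
    psQuotient * (1 + X * expand 3 three_ne_zero psQuotient * expand 3 three_ne_zero H) =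
      expand 3 three_ne_zero H ∧
    psQuotient = H ^ 3 * (1 - X * psQuotient ^ 4) := by
  set ψ := ramanujanPsi with hψ
  set a := contract 3 ψ with ha
  have a_const : constantCoeff a = 1 := by
    rw [ha, ← coeff_zero_eq_constantCoeff_apply, coeff_contract, mul_zero,
      coeff_zero_eq_constantCoeff_apply, constantCoeff_ramanujanPsi]
  have a_ne_zero : a ≠ 0 := fun h => by simp [h] at a_const
  have psi_ne_zero : ψ ≠ 0 := fun h => by simpa [← hψ, h] using constantCoeff_ramanujanPsi
  set H := ψ * invOfUnit a 1
  have H_mul : H * a = ψ := by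
    rw [mul_assoc, invOfUnit_mul _ _ (by simpa using a_const), mul_one]
  have expand_H_mul := congrArg (expand 3 three_ne_zero) H_mul
  have quotient_mul : psQuotient * ψ = expand 3 three_ne_zero ψ := psQuotient_mul_ramanujanPsi
  have expand_quotient_mul := congrArg (expand 3 three_ne_zero) quotient_mul
  have dissection : ψ = expand 3 three_ne_zero a + _ := ramanujanPsi_eq_expand_add
  have cubic : (a ^ 3 + _) * _ = ψ ^ 4 := cubic_identity
  rw [← hψ] at dissection cubic
  rw [map_mul] at expand_H_mul expand_quotient_mul
  refine ⟨H, mul_right_cancel₀ ((map_ne_zero_iff _ (expand_injective three_ne_zero)).2 a_ne_zero)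
    ?_, mul_right_cancel₀ (mul_ne_zero (pow_ne_zero 3 a_ne_zero) psi_ne_zero) ?_⟩
  · linear_combination (X * psQuotient * expand 3 three_ne_zero psQuotient - 1) * expand_H_mul +
      X * psQuotient * expand_quotient_mul - psQuotient * dissection + quotient_mul
  · rw [← quotient_mul] at cubic
    linear_combination cubic - (1 - X * psQuotient ^ 4) * ψ * congrArg (· ^ 3) H_mul

/-- The series `∑ ps₃(n) q ^ (4 n + 1) = q ψ(q ^ 12) / ψ(q ^ 4)`, in which the identities below
have polynomial coefficients and no fractional powers of `q`. -/
noncomputable def ps3Series : ℤ⟦X⟧ := X * expand 4 four_ne_zero psQuotient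

theorem coeff_ps3Series (n : ℕ) : coeff (4 * n + 1) ps3Series = ps3 n := by
  rw [ps3Series, coeff_succ_X_mul, coeff_expand_mul, ps3]

theorem exists_ps3Series_relations : ∃ h g : ℤ⟦X⟧, g = X * expand 3 three_ne_zero h ∧
    ps3Series * (1 + expand 3 three_ne_zero ps3Series * g) = g ∧
    expand 3 three_ne_zero ps3Series = g ^ 3 * (1 - expand 3 three_ne_zero ps3Series ^ 4) := by
  obtain ⟨H, linear, cubic⟩ := exists_psQuotient_relations
  have expand_comm (f : ℤ⟦X⟧) : expand 4 four_ne_zero (expand 3 three_ne_zero f) =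
      expand 3 three_ne_zero (expand 4 four_ne_zero f) := by
    rw [← PowerSeries.expand_mul, ← PowerSeries.expand_mul]
  replace linear := congrArg (expand 4 four_ne_zero) linear
  replace cubic := congrArg (fun f => expand 3 three_ne_zero (expand 4 four_ne_zero f)) cubic
  refine ⟨expand 4 four_ne_zero H, _, rfl, ?_, ?_⟩
  · simp only [map_mul, map_add, map_one, expand_X, expand_comm, ps3Series] at linear ⊢
    linear_combination X * linear
  · simp only [map_mul, map_sub, map_pow, map_one, expand_X, ps3Series] at cubic ⊢
    linear_combination X ^ 3 * cubic

theorem ps3Series_pow_three : ps3Series ^ 3 =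
    expand 3 three_ne_zero ps3Series - 3 * expand 3 three_ne_zero ps3Series ^ 2 * ps3Series +
      3 * expand 3 three_ne_zero ps3Series ^ 3 * ps3Series ^ 2 := by
  obtain ⟨h, g, -, linear, cubic⟩ := exists_ps3Series_relations
  set z := ps3Series
  set ζ := expand 3 three_ne_zero z
  have linear' : z = g * (1 - ζ * z) := by linear_combination linear
  linear_combination (1 - ζ ^ 4) * congrArg (· ^ 3) linear' - (1 - ζ * z) ^ 3 * cubic

theorem contract_three_quadratic {R : Type*} [CommRing R] (h A B C : R⟦X⟧) :
    contract 3 (expand 3 three_ne_zero A * (X * expand 3 three_ne_zero h) +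
      expand 3 three_ne_zero B * (X * expand 3 three_ne_zero h) ^ 2 +
        expand 3 three_ne_zero C) = C := by
  have contract_X_mul : contract 3 (X * expand 3 three_ne_zero h) = 0 := by
    rw [mul_comm X, contract_expand_mul, ← pow_one X, contract_X_pow (by decide), mul_zero]
  have contract_X_mul_sq : contract 3 ((X * expand 3 three_ne_zero h) ^ 2) = 0 := by
    rw [mul_pow, mul_comm (X ^ 2), ← map_pow, contract_expand_mul, contract_X_pow (by decide),
      mul_zero]
  rw [map_add, map_add, contract_expand_mul, contract_expand_mul, contract_X_mul,
    contract_X_mul_sq, contract_expand, mul_zero, mul_zero, zero_add, zero_add]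

theorem contract_ps3Series_and_sq : contract 3 ps3Series = ps3Series ^ 3 ∧
    contract 3 (ps3Series ^ 2) = 3 * ps3Series ^ 6 - 2 * ps3Series ^ 2 := by
  obtain ⟨h, g, g_eq, linear, cubic⟩ := exists_ps3Series_relations
  generalize ps3Series = z at *
  have contract_z := contract_three_quadratic h (1 - z ^ 4) (-((1 - z ^ 4) * z)) (z ^ 3)
  have contract_z_sq := contract_three_quadratic h (3 * (1 - z ^ 4) * z ^ 3)
    ((1 - z ^ 4) ^ 2 - 2 * (1 - z ^ 4) * z ^ 4) (3 * z ^ 6 - 2 * z ^ 2)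
  simp only [← g_eq, map_mul, map_sub, map_neg, map_pow, map_one, map_ofNat]
    at contract_z contract_z_sq
  generalize expand 3 three_ne_zero z = ζ at *
  have one_add_mul_inv : (1 + ζ * g) * ((1 - ζ * g + ζ ^ 2 * g ^ 2) * (1 - ζ ^ 4)) = 1 := by
    linear_combination -ζ ^ 3 * cubic
  have z_eq : z = (1 - ζ ^ 4) * g + -((1 - ζ ^ 4) * ζ) * g ^ 2 + ζ ^ 3 := by
    linear_combination (1 - ζ ^ 4) * (1 - ζ * g + ζ ^ 2 * g ^ 2) * linear
      - z * one_add_mul_inv - ζ ^ 2 * cubic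
  have z_sq_eq : z ^ 2 = 3 * (1 - ζ ^ 4) * ζ ^ 3 * g +
      ((1 - ζ ^ 4) ^ 2 - 2 * (1 - ζ ^ 4) * ζ ^ 4) * g ^ 2 + (3 * ζ ^ 6 - 2 * ζ ^ 2) := by
    linear_combination (z + ((1 - ζ ^ 4) * g + -((1 - ζ ^ 4) * ζ) * g ^ 2 + ζ ^ 3)) * z_eq +
      (2 * (1 - ζ ^ 4) * ζ - (1 - ζ ^ 4) * ζ ^ 2 * g) * cubic
  exact ⟨(congrArg (contract 3) z_eq).trans contract_z,
    (congrArg (contract 3) z_sq_eq).trans contract_z_sq⟩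

theorem contract_ps3Series_pow_add_three (n : ℕ) :
    contract 3 (ps3Series ^ (n + 3)) =
      3 * ps3Series ^ 3 * contract 3 (ps3Series ^ (n + 2)) -
      3 * ps3Series ^ 2 * contract 3 (ps3Series ^ (n + 1)) +
      ps3Series * contract 3 (ps3Series ^ n) := by
  rw [← contract_expand_mul three_ne_zero, ← contract_expand_mul three_ne_zero,
    ← contract_expand_mul three_ne_zero, ← map_sub, ← map_add]
  congr 1
  simp only [map_mul, map_pow, map_ofNat]
  linear_combination ps3Series ^ n * ps3Series_pow_three

/-- The polynomials with `contract 3 (ps3Series ^ k) = contractPoly k (ps3Series)`. -/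
noncomputable def contractPoly : ℕ → Polynomial ℤ
  | 0 => 1
  | 1 => .X ^ 3
  | 2 => 3 * .X ^ 6 - 2 * .X ^ 2
  | k + 3 => 3 * .X ^ 3 * contractPoly (k + 2) - 3 * .X ^ 2 * contractPoly (k + 1) +
      .X * contractPoly k

theorem aeval_contractPoly (k : ℕ) :
    Polynomial.aeval ps3Series (contractPoly k) = contract 3 (ps3Series ^ k) := by
  induction k using contractPoly.induct with
  | case1 => simp [contractPoly, contract_one]
  | case2 => simp [contractPoly, contract_ps3Series_and_sq.1]
  | case3 => simp [contractPoly, contract_ps3Series_and_sq.2, map_ofNat]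
  | case4 k ih2 ih1 ih0 =>
    simp [contractPoly, contract_ps3Series_pow_add_three, ih2, ih1, ih0, map_ofNat]

theorem eval_one_contractPoly (k : ℕ) : (contractPoly k).eval 1 = 1 := by
  induction k using contractPoly.induct with
  | case1 | case2 | case3 => simp [contractPoly]
  | case4 k ih2 ih1 ih0 => simp [contractPoly, ih2, ih1, ih0]

theorem coeff_contractPoly_add_three (k i : ℕ) : (contractPoly (k + 3)).coeff i =
    3 * (if 3 ≤ i then (contractPoly (k + 2)).coeff (i - 3) else 0) -
      3 * (if 2 ≤ i then (contractPoly (k + 1)).coeff (i - 2) else 0) +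
        if 1 ≤ i then (contractPoly k).coeff (i - 1) else 0 := by
  simp only [contractPoly, Polynomial.coeff_add, Polynomial.coeff_sub, mul_assoc,
    ← map_ofNat (Polynomial.C : ℤ →+* _) 3, Polynomial.coeff_C_mul, Polynomial.coeff_X_pow_mul']
  rw [← pow_one Polynomial.X, Polynomial.coeff_X_pow_mul']

theorem coeff_contractPoly_eq_zero {k i : ℕ} (h : ¬ 4 ∣ i + k) :
    (contractPoly k).coeff i = 0 := by
  induction k using contractPoly.induct generalizing i with
  | case1 => rw [contractPoly, Polynomial.coeff_one, if_neg (by omega)]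
  | case2 => rw [contractPoly, Polynomial.coeff_X_pow, if_neg (by omega)]
  | case3 =>
    simp [contractPoly, Polynomial.coeff_X_pow, show i ≠ 6 by omega, show i ≠ 2 by omega]
  | case4 k ih2 ih1 ih0 =>
    rw [coeff_contractPoly_add_three]
    split_ifs <;> simp (disch := omega) [ih2, ih1, ih0]

theorem three_pow_dvd_coeff_contractPoly (k i : ℕ) :
    3 ^ ((3 * i - (k + 1)) / 8) ∣ (contractPoly k).coeff i := by
  have weaken {a b : ℕ} {c : ℤ} (hab : a ≤ b) (h : 3 ^ b ∣ c) : 3 ^ a ∣ c :=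
    (pow_dvd_pow 3 hab).trans h
  induction k using contractPoly.induct generalizing i with
  | case1 =>
    rw [contractPoly, Polynomial.coeff_one]
    split_ifs with hi
    · simp [hi]
    · exact dvd_zero _
  | case2 =>
    rw [contractPoly, Polynomial.coeff_X_pow]
    split_ifs with hi
    · simp [hi]
    · exact dvd_zero _
  | case3 =>
    by_cases h6 : i = 6
    · simp [contractPoly, Polynomial.coeff_X_pow, h6]
    by_cases h2 : i = 2 <;> simp [contractPoly, Polynomial.coeff_X_pow, h6, h2]
  | case4 k ih2 ih1 ih0 =>
    rw [coeff_contractPoly_add_three]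
    refine dvd_add (dvd_sub ?_ ?_) ?_ <;> split_ifs
    · exact weaken (by omega) (pow_succ' (3 : ℤ) _ ▸ mul_dvd_mul_left 3 (ih2 (i - 3)))
    · simp
    · exact weaken (by omega) (pow_succ' (3 : ℤ) _ ▸ mul_dvd_mul_left 3 (ih1 (i - 2)))
    · simp
    · exact weaken (by omega) (ih0 (i - 1))
    · simp

/-- The operator on polynomials that describes the action of `contract 3` on `ℤ[ps3Series]`. -/
noncomputable def contractOp : Polynomial ℤ →ₗ[ℤ] Polynomial ℤ :=
  Polynomial.lsum fun k => LinearMap.toSpanSingleton ℤ _ (contractPoly k)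

theorem contractOp_apply (P : Polynomial ℤ) :
    contractOp P = P.sum fun k c => c • contractPoly k := by
  simp [contractOp]

theorem contractOp_X_pow (k : ℕ) : contractOp (.X ^ k) = contractPoly k := by
  simp [contractOp_apply, ← Polynomial.monomial_one_right_eq_X_pow, Polynomial.sum_monomial_index]

theorem aeval_contractOp (P : Polynomial ℤ) :
    Polynomial.aeval ps3Series (contractOp P) = contract 3 (Polynomial.aeval ps3Series P) := by
  induction P using Polynomial.induction_on' with
  | add P Q hP hQ => simp only [map_add, hP, hQ]
  | monomial k c =>
    simp only [← Polynomial.smul_X_eq_monomial, map_zsmul, contractOp_X_pow, aeval_contractPoly,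
      map_pow, Polynomial.aeval_X]

theorem aeval_contractOp_iterate (n : ℕ) (P : Polynomial ℤ) :
    Polynomial.aeval ps3Series (contractOp^[n] P) =
      (contract 3)^[n] (Polynomial.aeval ps3Series P) :=
  Function.Semiconj.iterate_right (f := Polynomial.aeval ps3Series) aeval_contractOp n P

theorem eval_one_contractOp (P : Polynomial ℤ) : (contractOp P).eval 1 = P.eval 1 := by
  rw [contractOp_apply, Polynomial.eval_eq_sum (p := P), Polynomial.sum_def,
    Polynomial.eval_finsetSum, Polynomial.sum_def]
  simp only [Polynomial.eval_smul, eval_one_contractPoly, smul_eq_mul, one_pow]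

theorem coeff_contractOp (P : Polynomial ℤ) (i : ℕ) :
    (contractOp P).coeff i = P.sum fun k c => c * (contractPoly k).coeff i := by
  simp [contractOp_apply, Polynomial.sum_def]

/-- Membership in the lattice spanned by the `3 ^ (n + (i - 4) / 8) X ^ i` with `i ≡ r` modulo `4`
(where `i - 4` is truncated), together with vanishing at `1`. The operator `contractOp` preserves
these conditions between `r = 1` and `r = 3`, and increases `n` when `r = 1`. -/
structure IsSmall (n r : ℕ) (P : Polynomial ℤ) : Prop where
  eval_one : P.eval 1 = 0
  mod_four : ∀ i, P.coeff i ≠ 0 → i % 4 = r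
  dvd_coeff : ∀ i, 3 ^ (n + (i - 4) / 8) ∣ P.coeff i

theorem dvd_coeff_contractOp {P : Polynomial ℤ} {a i : ℕ}
    (h : ∀ k, P.coeff k ≠ 0 → 4 ∣ i + k →
      ∃ b, 3 ^ b ∣ P.coeff k ∧ a ≤ b + (3 * i - (k + 1)) / 8) :
    3 ^ a ∣ (contractOp P).coeff i := by
  rw [coeff_contractOp]
  refine dvd_sum fun k hk => ?_
  by_cases hki : 4 ∣ i + k
  · obtain ⟨b, hb, hab⟩ := h k (Polynomial.mem_support_iff.1 hk) hki
    exact (pow_dvd_pow 3 hab).trans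
      (pow_add (3 : ℤ) _ _ ▸ mul_dvd_mul hb (three_pow_dvd_coeff_contractPoly k i))
  · simp [coeff_contractPoly_eq_zero hki]

theorem exists_coeff_ne_zero_of_coeff_contractOp_ne_zero {P : Polynomial ℤ} {i : ℕ}
    (h : (contractOp P).coeff i ≠ 0) : ∃ k, P.coeff k ≠ 0 ∧ 4 ∣ i + k := by
  rw [coeff_contractOp] at h
  obtain ⟨k, hk, hki⟩ := exists_ne_zero_of_sum_ne_zero h
  exact ⟨k, Polynomial.mem_support_iff.1 hk,
    not_not.1 fun h4 => hki (mul_eq_zero_of_right _ (coeff_contractPoly_eq_zero h4))⟩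

namespace IsSmall

variable {n : ℕ} {P : Polynomial ℤ}

theorem contractOp_of_three (hP : IsSmall n 3 P) : IsSmall n 1 (contractOp P) where
  eval_one := by rw [eval_one_contractOp, hP.eval_one]
  mod_four i hi := by
    obtain ⟨k, hk, hki⟩ := exists_coeff_ne_zero_of_coeff_contractOp_ne_zero hi
    have := hP.mod_four k hk
    omega
  dvd_coeff i := dvd_coeff_contractOp fun k hk hki => by
    have := hP.mod_four k hk
    exact ⟨_, hP.dvd_coeff k, by omega⟩

-- The coefficient of `X ^ 3` gains its factor of `3` from the vanishing at `1`.
theorem contractOp_of_one (hP : IsSmall n 1 P) : IsSmall (n + 1) 3 (contractOp P) := by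
  have eval_one : (contractOp P).eval 1 = 0 := by rw [eval_one_contractOp, hP.eval_one]
  have mod_four (i : ℕ) (hi : (contractOp P).coeff i ≠ 0) : i % 4 = 3 := by
    obtain ⟨k, hk, hki⟩ := exists_coeff_ne_zero_of_coeff_contractOp_ne_zero hi
    have := hP.mod_four k hk
    omega
  have dvd_of_ne_three (i : ℕ) (hi : i ≠ 3) :
      3 ^ (n + 1 + (i - 4) / 8) ∣ (contractOp P).coeff i := by
    by_cases h0 : (contractOp P).coeff i = 0
    · exact h0 ▸ dvd_zero _
    have := mod_four i h0
    refine dvd_coeff_contractOp fun k hk hki => ?_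
    have := hP.mod_four k hk
    exact ⟨_, hP.dvd_coeff k, by omega⟩
  refine ⟨eval_one, mod_four, fun i => ?_⟩
  rcases ne_or_eq i 3 with hi | rfl
  · exact dvd_of_ne_three i hi
  rw [Polynomial.eval_eq_sum, Polynomial.sum_def] at eval_one
  simp only [one_pow, mul_one] at eval_one
  by_cases h3 : 3 ∈ (contractOp P).support
  · rw [← add_sum_erase _ _ h3] at eval_one
    rw [eq_neg_of_add_eq_zero_left eval_one]
    exact (dvd_sum fun j hj => (pow_dvd_pow 3 (by omega)).trans
      (dvd_of_ne_three j (ne_of_mem_erase hj))).neg_right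
  · rw [Polynomial.notMem_support_iff.1 h3]
    exact dvd_zero _

theorem contractOp_iterate (hP : IsSmall n 1 P) (m : ℕ) :
    IsSmall (n + m + 1) 3 (contractOp^[2 * m + 1] P) := by
  induction m with
  | zero => exact hP.contractOp_of_one
  | succ m ih =>
    rw [show 2 * (m + 1) + 1 = 2 * m + 1 + 1 + 1 by ring, Function.iterate_succ_apply',
      Function.iterate_succ_apply']
    exact ih.contractOp_of_three.contractOp_of_one

end IsSmall

theorem isSmall_contractOp_iterate_X_sub :
    IsSmall 2 1 (contractOp^[2] .X - .X) := by
  have eq : contractOp^[2] .X - .X = (9 * .X ^ 9 - 9 * .X ^ 5 : Polynomial ℤ) := by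
    have h := contractOp_X_pow 1
    rw [pow_one] at h
    simp only [Function.iterate_succ_apply', Function.iterate_zero, id_eq, h, contractPoly,
      contractOp_X_pow]
    ring
  have coeff_eq (i : ℕ) : (9 * .X ^ 9 - 9 * .X ^ 5 : Polynomial ℤ).coeff i =
      if i = 9 then 9 else if i = 5 then -9 else 0 := by
    simp [Polynomial.coeff_X_pow]
    grind
  rw [eq]
  refine ⟨by simp, fun i => ?_, fun i => ?_⟩ <;> rw [coeff_eq]
  · grind
  · split_ifs with h9 h5
    · simp [h9]
    · simp [h5]
    · exact dvd_zero _

theorem three_pow_dvd_coeff_contract_iterate_sub (m i : ℕ) : 3 ^ (m + 3) ∣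
    coeff i ((contract 3)^[2 * m + 3] ps3Series - (contract 3)^[2 * m + 1] ps3Series) := by
  have small := isSmall_contractOp_iterate_X_sub.contractOp_iterate m
  have eq : (contract 3)^[2 * m + 3] ps3Series - (contract 3)^[2 * m + 1] ps3Series =
      Polynomial.aeval ps3Series (contractOp^[2 * m + 1] (contractOp^[2] .X - .X)) := by
    rw [iterate_map_sub, ← Function.iterate_add_apply, map_sub, aeval_contractOp_iterate,
      aeval_contractOp_iterate, Polynomial.aeval_X]
  rw [eq, Polynomial.aeval_eq_sum_range, map_sum]
  refine dvd_sum fun k _ => ?_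
  rw [coeff_smul, smul_eq_mul]
  exact ((pow_dvd_pow 3 (by omega)).trans (small.dvd_coeff k)).mul_right _

theorem ps3_eq_coeff_contract_iterate (k n : ℕ) :
    ps3 (3 ^ (2 * k + 1) * n + (3 ^ (2 * k + 2) - 1) / 4) =
      coeff (4 * n + 3) ((contract 3)^[2 * k + 1] ps3Series) := by
  obtain ⟨d, hd⟩ : ∃ d, 3 ^ (2 * k + 2) = 4 * d + 1 := by
    have : 3 ^ (2 * k + 2) % 4 = 1 := by
      rw [← Nat.mul_add_one, pow_mul, Nat.pow_mod]
      norm_num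
    exact ⟨3 ^ (2 * k + 2) / 4, by omega⟩
  have index : 4 * (3 ^ (2 * k + 1) * n + d) + 1 = 3 ^ (2 * k + 1) * (4 * n + 3) := by
    linear_combination -hd
  rw [coeff_contract_iterate, ← index, coeff_ps3Series, hd, Nat.add_sub_cancel,
    Nat.mul_div_cancel_left _ four_pos]

theorem theorem1p2 (m n : ℕ) (hm : 1 ≤ m) :
    ps3 (3 ^ (2 * m + 1) * n + (3 ^ (2 * m + 2) - 1) / 4) ≡
      ps3 (3 ^ (2 * m - 1) * n + (3 ^ (2 * m) - 1) / 4) [ZMOD 3 ^ (m + 2)] := by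
  obtain ⟨m, rfl⟩ := Nat.exists_eq_add_of_le' hm
  refine (Int.modEq_iff_dvd.2 ?_).symm
  rw [ps3_eq_coeff_contract_iterate]
  rw [show 2 * (m + 1) - 1 = 2 * m + 1 by omega, Nat.mul_add_one 2 m,
    ps3_eq_coeff_contract_iterate, ← map_sub]
  exact three_pow_dvd_coeff_contract_iterate_sub m _
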